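/- Let $\Phi(t)=\int_{-\infty}^t\frac{1}{\sqrt{2\pi}}e^{-x^2/2}\,\mathrm dx$. There exists an absolute constant $\zeta\in(0,1/2)$ such that the following holds. Let $a_1=a_1(n),\,a_2=a_2(n)\in\mathbb N$ and $p=p(n)\in[0,1]$ be sequences with $p\to 0$, $a_2\to\infty$, $a_2\le a_1$ for every $n$, and $\min\{a_2,a_1-a_2\}\,p\to\infty$ as $n\to\infty$. Put $q=1-p$. For every $n$ let $X_1\in\mathrm{Bin}(a_1,p)$ and $X_2\in\mathrm{Bin}(a_2,p)$ be independent binomial random variables on a probability space, which may depend on $n$. Then: 1. For every $M\in\mathbb R$ and every $n$ with $a_2(n)\ge 1$ and $0<p(n)\le 1/2$ (hence for all sufficiently large $n$, uniformly in $M$), $$\mathbb P(X_1-X_2\ge M)\ \ge\ \Phi\Big(\frac{(a_1-a_2)p-M}{\sqrt{(a_1+a_2)pq}}\Big)-\frac{2\zeta}{\sqrt{a_2p}}.$$ 2. For every fixed $M\in\mathbb R$ and all sufficiently large $n$ (depending on $M$ and on the sequences), $$\mathbb P(X_1-X_2\ge M)\ \ge\ \frac12+\frac15\min\Big\{1,\frac{(a_1-a_2)p}{\sqrt{(a_1+a_2)p}}\Big\}.$$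 3. For every fixed $m\in\mathbb Z$, as $n\to\infty$, $$\mathbb P(X_1-X_2=m)=o\big(\mathbb P(X_1-X_2\ge m)-\mathbb P(X_1-X_2<m)\big).$$ -/

import Mathlib

open Filter Topology MeasureTheory ProbabilityTheory Asymptotics

/-- The distribution function of the standard normal law,
`Φ t = ∫_{-∞}^t (2π)^(-1/2) exp (-x²/2) dx`. -/
noncomputable def stdNormalCDF (t : ℝ) : ℝ :=
  ∫ x in Set.Iic t, (1 / √(2 * Real.pi)) * Real.exp (-(x ^ 2 / 2))

/-! Everything rests on a one-sided Berry–Esseen bound with explicit constants for `X₁ - X₂`, proved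
by Stein's method. Let `f = steinSol z` solve `f' w - w f w = 1_{w ≤ z} - Φ z`. Summation by parts
for binomials turns `E[W f(W)]`, with `W` the standardized difference, into means of increments of
`f` over a lattice step. Such an increment is the integral of `f'` over the step. Comparing that
integral with a two-point average costs only the Lipschitz bound on `u f(u)`, and the `W f(W)` terms
cancel (`stein_step`, `binomDiffExp.le_of_step`, `binomDiffExp.cdf_le`). Part 1 follows from `(a₁ +
a₂) p ≥ 2 a₂ p`. With `D = (a₁ - a₂) p` and `N = (a₁ + a₂) p`, parts 2 and 3 hold because the error
and the point masses are `O(1/√N)`, which is `o(min(1, D/√N))` since `D → ∞` and `D ≤ N`. -/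

/-- The density of the standard normal law. -/
noncomputable def stdNormalPDF (x : ℝ) : ℝ :=
  (1 / √(2 * Real.pi)) * Real.exp (-(x ^ 2 / 2))

/-! ### Numerical and analytic facts on the Gaussian law. -/

lemma stdNormalPDF_pos (x : ℝ) : 0 < stdNormalPDF x := by
  unfold stdNormalPDF; positivity

lemma stdNormalPDF_neg (x : ℝ) : stdNormalPDF (-x) = stdNormalPDF x := by
  simp [stdNormalPDF]

lemma continuous_stdNormalPDF : Continuous stdNormalPDF := by
  unfold stdNormalPDF; fun_prop

lemma hasDerivAt_stdNormalPDF (x : ℝ) :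
    HasDerivAt stdNormalPDF (-x * stdNormalPDF x) x := by
  have h : HasDerivAt (fun x : ℝ => -(x ^ 2 / 2)) (-x) x := by
    have := ((hasDerivAt_pow 2 x).div_const 2).neg
    convert! this using 1
    simp; try ring
  convert! (h.exp.const_mul (1 / √(2 * Real.pi))) using 1
  unfold stdNormalPDF; ring

lemma integrable_stdNormalPDF : Integrable stdNormalPDF := by
  have := (integrable_exp_neg_mul_sq (b := 1 / 2) (by norm_num)).const_mul (1 / √(2 * Real.pi))
  refine this.congr (ae_of_all _ fun x => ?_)
  simp only [stdNormalPDF]; congr 2; ring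

lemma integral_stdNormalPDF : ∫ x, stdNormalPDF x = 1 := by
  have h : ∀ x, stdNormalPDF x = (1 / √(2 * Real.pi)) * Real.exp (-(1 / 2) * x ^ 2) := by
    intro x; simp only [stdNormalPDF]; congr 2; ring
  simp_rw [h]
  rw [integral_const_mul, integral_gaussian]
  have : Real.pi / (1 / 2) = 2 * Real.pi := by ring
  rw [this]
  have : √(2 * Real.pi) ≠ 0 := by positivity
  field_simp

lemma stdNormalCDF_eq (t : ℝ) : stdNormalCDF t = ∫ x in Set.Iic t, stdNormalPDF x := rfl

lemma stdNormalCDF_sub (a b : ℝ) :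
    stdNormalCDF b - stdNormalCDF a = ∫ x in a..b, stdNormalPDF x :=
  intervalIntegral.integral_Iic_sub_Iic integrable_stdNormalPDF.integrableOn
    integrable_stdNormalPDF.integrableOn

lemma hasDerivAt_stdNormalCDF (t : ℝ) : HasDerivAt stdNormalCDF (stdNormalPDF t) t := by
  have h : stdNormalCDF = fun t => stdNormalCDF 0 + ∫ x in (0 : ℝ)..t, stdNormalPDF x := by
    ext t; rw [← stdNormalCDF_sub]; ring
  rw [h]
  exact (intervalIntegral.integral_hasDerivAt_right
    (continuous_stdNormalPDF.intervalIntegrable _ _)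
    continuous_stdNormalPDF.stronglyMeasurable.stronglyMeasurableAtFilter
    continuous_stdNormalPDF.continuousAt).const_add _

lemma continuous_stdNormalCDF : Continuous stdNormalCDF :=
  continuous_iff_continuousAt.2 fun t => (hasDerivAt_stdNormalCDF t).continuousAt

lemma stdNormalCDF_mono : Monotone stdNormalCDF := by
  intro a b hab
  have := stdNormalCDF_sub a b
  have h2 : 0 ≤ ∫ x in a..b, stdNormalPDF x :=
    intervalIntegral.integral_nonneg hab fun x _ => (stdNormalPDF_pos x).le
  linarith

lemma stdNormalCDF_nonneg (t : ℝ) : 0 ≤ stdNormalCDF t :=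
  integral_nonneg fun x => (stdNormalPDF_pos x).le

lemma stdNormalCDF_add_neg (t : ℝ) : stdNormalCDF t + stdNormalCDF (-t) = 1 := by
  have h : stdNormalCDF (-t) = ∫ x in Set.Ioi t, stdNormalPDF x := by
    rw [stdNormalCDF_eq, ← integral_comp_neg_Ioi]
    simp_rw [stdNormalPDF_neg]
  rw [h, stdNormalCDF_eq, intervalIntegral.integral_Iic_add_Ioi
    integrable_stdNormalPDF.integrableOn integrable_stdNormalPDF.integrableOn,
    integral_stdNormalPDF]

lemma stdNormalCDF_zero : stdNormalCDF 0 = 1 / 2 := by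
  have := stdNormalCDF_add_neg 0
  simp at this; linarith

lemma inv_sqrt_two_pi_le : 1 / √(2 * Real.pi) ≤ 0.39895 := by
  rw [div_le_iff₀ (by positivity)]
  have : (2.50658 : ℝ) ≤ √(2 * Real.pi) := by
    apply Real.le_sqrt_of_sq_le
    have := Real.pi_gt_d6
    norm_num at this ⊢; linarith
  linarith

lemma le_inv_sqrt_two_pi : 0.3989 ≤ 1 / √(2 * Real.pi) := by
  rw [le_div_iff₀ (by positivity)]
  have : √(2 * Real.pi) ≤ (2.50664 : ℝ) := by
    apply Real.sqrt_le_iff.2 ⟨by norm_num, ?_⟩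
    have := Real.pi_lt_d6
    norm_num at this ⊢; linarith
  linarith

lemma stdNormalPDF_le (x : ℝ) : stdNormalPDF x ≤ 0.39895 := by
  have h : Real.exp (-(x ^ 2 / 2)) ≤ 1 := Real.exp_le_one_iff.2 (by nlinarith [sq_nonneg x])
  have h0 := inv_sqrt_two_pi_le
  have : 0 < 1 / √(2 * Real.pi) := by positivity
  unfold stdNormalPDF
  nlinarith

lemma stdNormalCDF_add_le (x : ℝ) {d : ℝ} (hd : 0 ≤ d) :
    stdNormalCDF (x + d) ≤ stdNormalCDF x + 0.39895 * d := by
  have h := stdNormalCDF_sub x (x + d)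
  have h2 : ∫ u in x..(x + d), stdNormalPDF u ≤ ∫ u in x..(x + d), (0.39895 : ℝ) :=
    intervalIntegral.integral_mono_on (by linarith)
      (continuous_stdNormalPDF.intervalIntegrable _ _) (by simp) fun u _ => stdNormalPDF_le u
  simp at h2
  norm_num at h2 ⊢
  linarith

lemma le_stdNormalPDF {x : ℝ} (h0 : 0 ≤ x) (h1 : x ≤ 1) : 0.24 ≤ stdNormalPDF x := by
  have h : Real.exp (-(1 / 2)) ≤ Real.exp (-(x ^ 2 / 2)) := Real.exp_le_exp.2 (by nlinarith)
  have h2 : (0.605 : ℝ) ≤ Real.exp (-(1 / 2)) := by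
    have := Real.exp_one_lt_d9
    have e : Real.exp (-(1 / 2)) ^ 2 * Real.exp 1 = 1 := by
      rw [← Real.exp_nat_mul, ← Real.exp_add]; norm_num
    by_contra! hc
    have := Real.exp_pos (-(1 / 2))
    nlinarith
  have h3 := le_inv_sqrt_two_pi
  unfold stdNormalPDF
  nlinarith

/-- The density is at least 0.24 on `[0, 1]`. The excess of 0.24 over 1/5 absorbs the errors in part
2. -/
lemma half_add_min_le_stdNormalCDF {x : ℝ} (h0 : 0 ≤ x) :
    1 / 2 + 0.24 * min 1 x ≤ stdNormalCDF x := by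
  have key : ∀ y, 0 ≤ y → y ≤ 1 → 1 / 2 + 0.24 * y ≤ stdNormalCDF y := by
    intro y hy hy1
    have h := stdNormalCDF_sub 0 y
    have h2 : ∫ u in (0 : ℝ)..y, (0.24 : ℝ) ≤ ∫ u in (0 : ℝ)..y, stdNormalPDF u :=
      intervalIntegral.integral_mono_on hy (by simp)
        (continuous_stdNormalPDF.intervalIntegrable _ _)
        fun u hu => le_stdNormalPDF hu.1 (hu.2.trans hy1)
    rw [stdNormalCDF_zero] at h
    simp at h2
    norm_num at h2 ⊢
    linarith
  exact (key _ (le_min zero_le_one h0) (min_le_left _ _)).trans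
    (stdNormalCDF_mono (min_le_right _ _))

lemma tendsto_stdNormalPDF_atTop : Tendsto stdNormalPDF atTop (𝓝 0) := by
  have h : Tendsto (fun x : ℝ => x ^ 2 / 2) atTop atTop :=
    (tendsto_pow_atTop two_ne_zero).atTop_div_const (by norm_num)
  have := (Real.tendsto_exp_neg_atTop_nhds_zero.comp h).const_mul (1 / √(2 * Real.pi))
  rw [mul_zero] at this
  exact this

lemma tendsto_stdNormalPDF_atBot : Tendsto stdNormalPDF atBot (𝓝 0) := by
  have := tendsto_stdNormalPDF_atTop.comp tendsto_neg_atBot_atTop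
  exact this.congr fun x => stdNormalPDF_neg x

/-- Mills' inequality. -/
lemma mul_stdNormalCDF_neg_le {w : ℝ} (hw : 0 ≤ w) :
    w * stdNormalCDF (-w) ≤ stdNormalPDF w := by
  have hnn : ∀ x ∈ Set.Iic (-w), 0 ≤ -x * stdNormalPDF x := fun x hx =>
    mul_nonneg (by simp at hx; linarith) (stdNormalPDF_pos x).le
  have hint : IntegrableOn (fun x => -x * stdNormalPDF x) (Set.Iic (-w)) := by
    have := (integrable_mul_exp_neg_mul_sq (b := 1 / 2) (by norm_num)).const_mul
      (-(1 / √(2 * Real.pi)))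
    refine (this.congr (ae_of_all _ fun x => ?_)).integrableOn
    have e : -(x ^ 2 / 2) = -(1 / 2) * x ^ 2 := by ring
    simp only [stdNormalPDF, e]; ring
  have h1 : ∫ x in Set.Iic (-w), -x * stdNormalPDF x = stdNormalPDF (-w) - 0 :=
    integral_Iic_of_hasDerivAt_of_tendsto' (fun x _ => hasDerivAt_stdNormalPDF x) hint
      tendsto_stdNormalPDF_atBot
  rw [stdNormalPDF_neg, sub_zero] at h1
  rw [← h1, stdNormalCDF_eq, ← integral_const_mul]
  refine setIntegral_mono_on (integrable_stdNormalPDF.integrableOn.const_mul _) hint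
    measurableSet_Iic fun x hx => ?_
  have := stdNormalPDF_pos x
  simp at hx
  nlinarith

/-! ### Stein's equation: bounds on the solution. -/

/-- The bounded solution of Stein's equation `f' w - w * f w = 1_{w ≤ z} - Φ z`. -/
noncomputable def steinSol (z w : ℝ) : ℝ :=
  stdNormalCDF (min w z) * stdNormalCDF (-max w z) / stdNormalPDF w

lemma steinSol_of_le {z w : ℝ} (h : w ≤ z) :
    steinSol z w = stdNormalCDF w * stdNormalCDF (-z) / stdNormalPDF w := by
  simp [steinSol, h]

lemma steinSol_of_ge {z w : ℝ} (h : z ≤ w) :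
    steinSol z w = stdNormalCDF z * stdNormalCDF (-w) / stdNormalPDF w := by
  simp [steinSol, h]

lemma continuous_steinSol (z : ℝ) : Continuous (steinSol z) := by
  unfold steinSol
  refine Continuous.div ?_ continuous_stdNormalPDF fun x => (stdNormalPDF_pos x).ne'
  exact (continuous_stdNormalCDF.comp (by fun_prop)).mul
    (continuous_stdNormalCDF.comp (by fun_prop))

lemma steinSol_nonneg (z w : ℝ) : 0 ≤ steinSol z w :=
  div_nonneg (mul_nonneg (stdNormalCDF_nonneg _) (stdNormalCDF_nonneg _)) (stdNormalPDF_pos w).le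

/-- For `w² ≤ 0.98` the product is at most 1/4 while the density exceeds 0.2443; beyond that, Mills'
inequality gives the factor `1/w`. -/
lemma stdNormalCDF_mul_neg_le (w : ℝ) :
    stdNormalCDF w * stdNormalCDF (-w) ≤ 1.025 * stdNormalPDF w := by
  wlog hw : 0 ≤ w generalizing w
  · have := this (-w) (by linarith)
    rw [stdNormalPDF_neg, neg_neg] at this
    linarith
  have h1 := stdNormalCDF_add_neg w
  have hw0 := stdNormalCDF_nonneg w
  have hw1 := stdNormalCDF_nonneg (-w)
  have hp := stdNormalPDF_pos w
  rcases le_total (w ^ 2) 0.98 with h | h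
  · have e : (0.6125 : ℝ) ≤ Real.exp (-(0.49)) := by
      have := Real.exp_one_lt_d9
      -- Integer powers reduce the estimate to the known decimal bound on `e`.
      have e : Real.exp (-(0.49)) ^ 100 * Real.exp 1 ^ 49 = 1 := by
        rw [← Real.exp_nat_mul, ← Real.exp_nat_mul, ← Real.exp_add]; norm_num
      by_contra! hc
      have a : Real.exp (-(0.49)) ^ 100 ≤ 0.6125 ^ 100 :=
        pow_le_pow_left₀ (Real.exp_pos _).le hc.le _
      have b : Real.exp 1 ^ 49 ≤ 2.7182818286 ^ 49 :=
        pow_le_pow_left₀ (Real.exp_pos _).le this.le _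
      have := mul_le_mul a b (by positivity) (by positivity)
      rw [e] at this
      norm_num at this
    have e2 : Real.exp (-(0.49)) ≤ Real.exp (-(w ^ 2 / 2)) :=
      Real.exp_le_exp.2 (by linarith)
    have h3 := le_inv_sqrt_two_pi
    have : (0.2443 : ℝ) ≤ stdNormalPDF w := by
      unfold stdNormalPDF; nlinarith
    nlinarith [sq_nonneg (stdNormalCDF w - stdNormalCDF (-w))]
  · have hm := mul_stdNormalCDF_neg_le hw
    have hw2 : 0.98 ≤ w := by nlinarith
    have : stdNormalCDF w ≤ 1 := by linarith
    have h4 : stdNormalCDF w * stdNormalCDF (-w) ≤ stdNormalCDF (-w) := by nlinarith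
    have : 1 ≤ 1.025 * w := by nlinarith
    nlinarith

lemma steinSol_le (z w : ℝ) : steinSol z w ≤ 1.025 := by
  unfold steinSol
  rw [div_le_iff₀ (stdNormalPDF_pos w)]
  refine (mul_le_mul (stdNormalCDF_mono (min_le_left _ _)) (stdNormalCDF_mono ?_)
    (stdNormalCDF_nonneg _) (stdNormalCDF_nonneg _)).trans (stdNormalCDF_mul_neg_le w)
  exact neg_le_neg (le_max_left _ _)

/-- The derivative of `steinSol z` away from `z`. -/
noncomputable def steinDeriv (z w : ℝ) : ℝ :=
  w * steinSol z w + (Set.Iic z).indicator 1 w - stdNormalCDF z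

lemma hasDerivAt_steinSol {z w : ℝ} (h : w ≠ z) :
    HasDerivAt (steinSol z) (steinDeriv z w) w := by
  have hp := (stdNormalPDF_pos w).ne'
  rcases h.lt_or_gt with h | h
  · have h1 := (((hasDerivAt_stdNormalCDF w).mul_const (stdNormalCDF (-z))).div
      (hasDerivAt_stdNormalPDF w) hp)
    have h2 : steinSol z =ᶠ[𝓝 w]
        fun w => stdNormalCDF w * stdNormalCDF (-z) / stdNormalPDF w := by
      filter_upwards [Iio_mem_nhds h] with x hx using steinSol_of_le (le_of_lt hx)
    refine (h1.congr_of_eventuallyEq h2).congr_deriv ?_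
    have := stdNormalCDF_add_neg z
    rw [steinDeriv, steinSol_of_le h.le, Set.indicator_of_mem (Set.mem_Iic.2 h.le)]
    rw [Pi.one_apply, show stdNormalCDF z = 1 - stdNormalCDF (-z) by linarith]
    field_simp
    ring
  · have h0 : HasDerivAt (fun w => stdNormalCDF (-w)) (-stdNormalPDF w) w := by
      have := (hasDerivAt_stdNormalCDF (-w)).comp w (hasDerivAt_neg w)
      rw [stdNormalPDF_neg, mul_neg_one] at this
      exact this
    have h1 := ((h0.const_mul (stdNormalCDF z)).div (hasDerivAt_stdNormalPDF w) hp)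
    have h2 : steinSol z =ᶠ[𝓝 w]
        fun w => stdNormalCDF z * stdNormalCDF (-w) / stdNormalPDF w := by
      filter_upwards [Ioi_mem_nhds h] with x hx using steinSol_of_ge (le_of_lt hx)
    refine (h1.congr_of_eventuallyEq h2).congr_deriv ?_
    rw [steinDeriv, steinSol_of_ge h.le, Set.indicator_of_notMem (by simpa using h)]
    field_simp
    ring

/-- When 0 is not strictly between `w` and the far side of `z`, Mills' inequality puts the bracket
in `e` in `[0, 1]`; otherwise it bounds the derivative by `Φ(-z) + Φ(w)` or `Φ(z) + Φ(-w)`, at most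
1 by monotonicity. -/
lemma abs_steinDeriv_le (z w : ℝ) : |steinDeriv z w| ≤ 1 := by
  have hp := stdNormalPDF_pos w
  have hz := stdNormalCDF_add_neg z
  have hw := stdNormalCDF_add_neg w
  have z0 := stdNormalCDF_nonneg z
  have z1 := stdNormalCDF_nonneg (-z)
  have w0 := stdNormalCDF_nonneg w
  have w1 := stdNormalCDF_nonneg (-w)
  rcases le_or_gt w z with h | h
  · have e : steinDeriv z w =
        stdNormalCDF (-z) * (1 + w * stdNormalCDF w / stdNormalPDF w) := by
      rw [steinDeriv, steinSol_of_le h, Set.indicator_of_mem (Set.mem_Iic.2 h), Pi.one_apply]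
      linear_combination -hz
    have hm := stdNormalCDF_mono h
    have hm' := stdNormalCDF_mono (neg_le_neg h)
    rw [e]
    rcases le_total 0 w with h0 | h0
    · have M := mul_stdNormalCDF_neg_le h0
      have M2 : w * stdNormalCDF (-z) / stdNormalPDF w ≤ 1 := by
        rw [div_le_one hp]; nlinarith
      have M3 : 0 ≤ w * stdNormalCDF w / stdNormalPDF w := by positivity
      rw [abs_of_nonneg (by positivity)]
      calc _ = stdNormalCDF (-z) + stdNormalCDF w * (w * stdNormalCDF (-z) / stdNormalPDF w) := by
            ring
        _ ≤ stdNormalCDF (-z) + stdNormalCDF w * 1 := by gcongr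
        _ ≤ 1 := by linarith
    · have M := mul_stdNormalCDF_neg_le (neg_nonneg.2 h0)
      rw [neg_neg, stdNormalPDF_neg] at M
      have M2 : -1 ≤ w * stdNormalCDF w / stdNormalPDF w := by
        rw [le_div_iff₀ hp]; linarith
      have M3 : w * stdNormalCDF w / stdNormalPDF w ≤ 0 :=
        div_nonpos_of_nonpos_of_nonneg (mul_nonpos_of_nonpos_of_nonneg h0 w0) hp.le
      rw [abs_of_nonneg (mul_nonneg z1 (by linarith))]
      nlinarith
  · have e : steinDeriv z w =
        -(stdNormalCDF z * (1 - w * stdNormalCDF (-w) / stdNormalPDF w)) := by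
      rw [steinDeriv, steinSol_of_ge h.le, Set.indicator_of_notMem (by simpa using h)]
      ring
    have hm := stdNormalCDF_mono h.le
    have hm' := stdNormalCDF_mono (neg_le_neg h.le)
    rw [e, abs_neg]
    rcases le_total 0 w with h0 | h0
    · have M := mul_stdNormalCDF_neg_le h0
      have M2 : w * stdNormalCDF (-w) / stdNormalPDF w ≤ 1 := by
        rwa [div_le_one hp]
      have M3 : 0 ≤ w * stdNormalCDF (-w) / stdNormalPDF w := by positivity
      rw [abs_of_nonneg (mul_nonneg z0 (by linarith))]
      nlinarith
    · have M := mul_stdNormalCDF_neg_le (neg_nonneg.2 h0)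
      rw [neg_neg, stdNormalPDF_neg] at M
      have M2 : -w * stdNormalCDF z / stdNormalPDF w ≤ 1 := by
        rw [div_le_one hp]; nlinarith
      have M3 : 0 ≤ -w * stdNormalCDF (-w) / stdNormalPDF w := by
        have : 0 ≤ -w := by linarith
        positivity
      have e : stdNormalCDF z * (1 - w * stdNormalCDF (-w) / stdNormalPDF w) =
        stdNormalCDF z + stdNormalCDF (-w) * (-w * stdNormalCDF z / stdNormalPDF w) := by ring
      have M4 : 0 ≤ -w * stdNormalCDF z / stdNormalPDF w := by
        have : 0 ≤ -w := by linarith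
        positivity
      rw [e, abs_of_nonneg (by positivity)]
      calc _ ≤ stdNormalCDF z + stdNormalCDF (-w) * 1 := by gcongr
        _ ≤ 1 := by linarith

lemma intervalIntegrable_indicator_Iic (z a b : ℝ) :
    IntervalIntegrable ((Set.Iic z).indicator (1 : ℝ → ℝ)) volume a b := by
  rw [intervalIntegrable_iff]
  exact (integrableOn_const (C := (1 : ℝ)) (by simp)).indicator measurableSet_Iic

lemma intervalIntegrable_steinDeriv (z a b : ℝ) :
    IntervalIntegrable (steinDeriv z) volume a b :=
  (((continuous_id.mul (continuous_steinSol z)).intervalIntegrable a b).add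
    (intervalIntegrable_indicator_Iic z a b)).sub intervalIntegrable_const

lemma integral_steinDeriv (z a b : ℝ) :
    ∫ u in a..b, steinDeriv z u = steinSol z b - steinSol z a :=
  MeasureTheory.integral_eq_of_hasDerivAt_off_countable _ _ (Set.countable_singleton z)
    (continuous_steinSol z).continuousOn (fun _ hx => hasDerivAt_steinSol hx.2)
    (intervalIntegrable_steinDeriv z a b)

lemma abs_steinSol_sub_le (z a b : ℝ) : |steinSol z b - steinSol z a| ≤ |b - a| := by
  rw [← integral_steinDeriv]
  have := intervalIntegral.norm_integral_le_of_norm_le_const (a := a) (b := b)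
    (f := steinDeriv z) (C := 1) fun x _ => abs_steinDeriv_le z x
  simpa using this

lemma abs_mul_steinSol_sub_le (z a b : ℝ) :
    |b * steinSol z b - a * steinSol z a| ≤ (|a| + 1.025) * |b - a| := by
  have e : b * steinSol z b - a * steinSol z a =
    a * (steinSol z b - steinSol z a) + (b - a) * steinSol z b := by ring
  rw [e]
  refine (abs_add_le _ _).trans ?_
  rw [abs_mul, abs_mul, abs_of_nonneg (steinSol_nonneg z b), add_mul]
  have h1 := abs_steinSol_sub_le z a b
  have h2 := steinSol_le z b
  have := abs_nonneg a
  have := abs_nonneg (b - a)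
  nlinarith

lemma le_integral_mul_steinSol (z a : ℝ) {d : ℝ} (hd : 0 ≤ d) :
    d * (a * steinSol z a) - (|a| + 1.025) * d ^ 2 / 2 ≤
      ∫ u in a..a + d, u * steinSol z u := by
  have h : ∫ u in a..a + d, (a * steinSol z a - (|a| + 1.025) * (u - a)) ≤
      ∫ u in a..a + d, u * steinSol z u := by
    refine intervalIntegral.integral_mono_on (by linarith)
      (Continuous.intervalIntegrable (by fun_prop) _ _)
      ((continuous_id.mul (continuous_steinSol z)).intervalIntegrable _ _) fun u hu => ?_
    have := (abs_le.1 (abs_mul_steinSol_sub_le z a u)).1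
    rw [abs_of_nonneg (sub_nonneg.2 hu.1)] at this
    linarith
  refine le_trans (le_of_eq ?_) h
  rw [intervalIntegral.integral_sub (by simp)
    (Continuous.intervalIntegrable (by fun_prop) _ _), intervalIntegral.integral_const,
    intervalIntegral.integral_const_mul, intervalIntegral.integral_sub (by simp) (by simp)]
  simp
  ring

lemma le_integral_mul_steinSol' (z a : ℝ) {d : ℝ} (hd : 0 ≤ d) :
    d * (a * steinSol z a) - (|a| + 1.025) * d ^ 2 / 2 ≤
      ∫ u in a - d..a, u * steinSol z u := by
  have h : ∫ u in a - d..a, (a * steinSol z a - (|a| + 1.025) * (a - u)) ≤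
      ∫ u in a - d..a, u * steinSol z u := by
    refine intervalIntegral.integral_mono_on (by linarith)
      (Continuous.intervalIntegrable (by fun_prop) _ _)
      ((continuous_id.mul (continuous_steinSol z)).intervalIntegrable _ _) fun u hu => ?_
    have := (abs_le.1 (abs_mul_steinSol_sub_le z a u)).1
    rw [abs_sub_comm u a, abs_of_nonneg (sub_nonneg.2 hu.2)] at this
    linarith
  refine le_trans (le_of_eq ?_) h
  rw [intervalIntegral.integral_sub (by simp)
    (Continuous.intervalIntegrable (by fun_prop) _ _), intervalIntegral.integral_const,
    intervalIntegral.integral_const_mul, intervalIntegral.integral_sub (by simp) (by simp)]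
  simp
  ring

/-- Only a lower bound `γ` for the fraction of the step lying left of `z` is needed, since the final
estimate is one-sided. -/
lemma le_integral_indicator_Iic {z a h γ : ℝ} (hh : 0 ≤ h) (h0 : 0 ≤ γ) (h1 : γ ≤ 1)
    (hγ : γ = 0 ∨ a + γ * h ≤ z) :
    h * γ ≤ ∫ u in a..a + h, (Set.Iic z).indicator (1 : ℝ → ℝ) u := by
  have hnn : ∀ u, 0 ≤ (Set.Iic z).indicator (1 : ℝ → ℝ) u :=
    fun u => Set.indicator_nonneg (fun _ _ => zero_le_one) u
  have h2 : γ * h ≤ h := by nlinarith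
  have h3 : 0 ≤ γ * h := by positivity
  rcases hγ with rfl | hγ
  · simpa using intervalIntegral.integral_nonneg (by linarith) fun u _ => hnn u
  rw [← intervalIntegral.integral_add_adjacent_intervals (b := a + γ * h)
    (intervalIntegrable_indicator_Iic z _ _) (intervalIntegrable_indicator_Iic z _ _)]
  have e : ∫ u in a..a + γ * h, (Set.Iic z).indicator (1 : ℝ → ℝ) u =
      ∫ u in a..a + γ * h, (1 : ℝ) := by
    refine intervalIntegral.integral_congr fun u hu => ?_
    rw [Set.uIcc_of_le (by linarith)] at hu
    exact Set.indicator_of_mem (Set.mem_Iic.2 (hu.2.trans hγ)) _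
  have := intervalIntegral.integral_nonneg (μ := volume) (a := a + γ * h) (b := a + h)
    (by linarith) fun u _ => hnn u
  rw [e]
  simp
  linarith

/-- One-step comparison of a two-point law on `{w, w + h}` with the uniform law on `[w, w + h]`
through Stein's equation. -/
lemma stein_step {z w h α β γ : ℝ} (hh : 0 ≤ h) (hα : 0 ≤ α) (hβ : 0 ≤ β) (hαβ : α + β = 1)
    (h0 : 0 ≤ γ) (h1 : γ ≤ 1) (hγ : γ = 0 ∨ w + γ * h ≤ z) :
    h * (γ - stdNormalCDF z)
      + h * (α * (w * steinSol z w) + β * ((w + h) * steinSol z (w + h)))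
      - h ^ 2 / 2 * (α ^ 2 * (|w| + 1.025) + β ^ 2 * (|w + h| + 1.025))
      ≤ steinSol z (w + h) - steinSol z w := by
  -- Cut the step at `w + α h`, so that each endpoint represents a piece of length proportional to
  -- its mass; this yields the squares `α²`, `β²` in the error.
  have i1 := le_integral_mul_steinSol z w (d := α * h) (by positivity)
  have i2 := le_integral_mul_steinSol' z (w + h) (d := β * h) (by positivity)
  have e : w + h - β * h = w + α * h := by linear_combination -h * hαβ
  rw [e] at i2
  have hc : Continuous fun u => u * steinSol z u := continuous_id.mul (continuous_steinSol z)
  have i3 := intervalIntegral.integral_add_adjacent_intervals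
    (hc.intervalIntegrable (μ := volume) w (w + α * h))
    (hc.intervalIntegrable (w + α * h) (w + h))
  have i4 := le_integral_indicator_Iic hh h0 h1 hγ
  rw [← integral_steinDeriv]
  unfold steinDeriv
  rw [intervalIntegral.integral_sub ((hc.intervalIntegrable _ _).add
      (intervalIntegrable_indicator_Iic z _ _)) (by simp),
    intervalIntegral.integral_add (hc.intervalIntegrable _ _)
      (intervalIntegrable_indicator_Iic z _ _)]
  simp only [intervalIntegral.integral_const, smul_eq_mul, add_sub_cancel_left]
  linarith

/-! ### Binomial expectations and summation by parts. -/

/-- The expectation of `H` under the binomial law with parameters `n` and `p`. -/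
noncomputable def binomExp (p : ℝ) : ℕ → (ℕ → ℝ) → ℝ
  | 0, H => H 0
  | n + 1, H => (1 - p) * binomExp p n H + p * binomExp p n fun k => H (k + 1)

namespace binomExp

lemma add (p : ℝ) (n : ℕ) (G H : ℕ → ℝ) :
    binomExp p n (fun k => G k + H k) = binomExp p n G + binomExp p n H := by
  induction n generalizing G H with
  | zero => rfl
  | succ n ih => simp only [binomExp, ih]; ring

lemma const_mul (p : ℝ) (n : ℕ) (c : ℝ) (H : ℕ → ℝ) :
    binomExp p n (fun k => c * H k) = c * binomExp p n H := by
  induction n generalizing H with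
  | zero => rfl
  | succ n ih => simp only [binomExp, ih]; ring

lemma const (p : ℝ) (n : ℕ) (c : ℝ) : binomExp p n (fun _ => c) = c := by
  induction n with
  | zero => rfl
  | succ n ih => simp only [binomExp, ih]; ring

lemma mono {p : ℝ} (h0 : 0 ≤ p) (h1 : p ≤ 1) (n : ℕ) {G H : ℕ → ℝ} (h : ∀ k, G k ≤ H k) :
    binomExp p n G ≤ binomExp p n H := by
  induction n generalizing G H with
  | zero => exact h 0
  | succ n ih =>
    exact add_le_add (mul_le_mul_of_nonneg_left (ih h) (by linarith))
      (mul_le_mul_of_nonneg_left (ih fun k => h (k + 1)) h0)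

lemma succ_eq (p : ℝ) (n : ℕ) (H : ℕ → ℝ) :
    binomExp p (n + 1) H = binomExp p n fun k => (1 - p) * H k + p * H (k + 1) := by
  rw [add, const_mul, const_mul]; rfl

/-- Size-bias identity, from which Stein's identity follows. -/
lemma natCast_mul_succ (p : ℝ) (n : ℕ) (H : ℕ → ℝ) :
    binomExp p (n + 1) (fun k => (k : ℝ) * H k) =
      (n + 1) * p * binomExp p n (fun k => H (k + 1)) := by
  induction n generalizing H with
  | zero => simp [binomExp]
  | succ n ih =>
    rw [binomExp, ih]
    have e : (fun k : ℕ => ((k + 1 : ℕ) : ℝ) * H (k + 1)) =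
        fun k : ℕ => (k : ℝ) * H (k + 1) + H (k + 1) := by
      funext k; push_cast; ring
    rw [e, add, ih fun k => H (k + 1), binomExp]
    push_cast; ring

/-- Stein's identity for the binomial law. -/
lemma stein (p : ℝ) (n : ℕ) (H : ℕ → ℝ) :
    binomExp p n (fun k => ((k : ℝ) - n * p) * H k) =
      n * (p * (1 - p)) * binomExp p (n - 1) (fun k => H (k + 1) - H k) := by
  cases n with
  | zero => simp [binomExp]
  | succ n =>
    have e : (fun k : ℕ => ((k : ℝ) - (n + 1 : ℕ) * p) * H k) =
        fun k : ℕ => (k : ℝ) * H k + (-((n + 1) * p)) * H k := by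
      funext k; push_cast; ring
    have e2 : (fun k : ℕ => H (k + 1) - H k) = fun k : ℕ => H (k + 1) + (-1) * H k := by
      funext k; ring
    rw [e, add, natCast_mul_succ, const_mul, Nat.add_sub_cancel, e2, add, const_mul, binomExp]
    push_cast; ring

/-- If a one-step average of `L` is dominated by the increments of `H`, then the mean of `L` is
dominated by the covariance of `H` with the identity. -/
lemma le_of_step {p : ℝ} (h0 : 0 ≤ p) (h1 : p ≤ 1) (n : ℕ) {L H : ℕ → ℝ}
    (h : ∀ k, (1 - p) * L k + p * L (k + 1) ≤ H (k + 1) - H k) :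
    n * (p * (1 - p)) * binomExp p n L ≤ binomExp p n (fun k => ((k : ℝ) - n * p) * H k) := by
  rw [stein]
  cases n with
  | zero => simp
  | succ n =>
    -- Splitting off one trial of `L` produces the one-step average, leaving `n - 1` trials as in
    -- `stein`.
    rw [succ_eq]
    exact mul_le_mul_of_nonneg_left (mono h0 h1 _ h)
      (mul_nonneg (Nat.cast_nonneg _) (mul_nonneg h0 (sub_nonneg.2 h1)))

lemma comm (p : ℝ) (a b : ℕ) (H : ℕ → ℕ → ℝ) :
    binomExp p a (fun i => binomExp p b fun j => H i j) =
      binomExp p b fun j => binomExp p a fun i => H i j := by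
  induction a generalizing H with
  | zero => rfl
  | succ a ih =>
    simp only [binomExp]
    rw [ih, ih fun i j => H (i + 1) j, add, const_mul, const_mul]

end binomExp

/-! ### The difference of two binomials and its normal approximation. -/

/-- The expectation of `H (X₁ - X₂)` for independent `X₁ ∈ Bin(a, p)` and `X₂ ∈ Bin(b, p)`. -/
noncomputable def binomDiffExp (p : ℝ) (a b : ℕ) (H : ℤ → ℝ) : ℝ :=
  binomExp p a fun i => binomExp p b fun j => H ((i : ℤ) - j)

namespace binomDiffExp

lemma add (p : ℝ) (a b : ℕ) (G H : ℤ → ℝ) :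
    binomDiffExp p a b (fun k => G k + H k) = binomDiffExp p a b G + binomDiffExp p a b H := by
  simp only [binomDiffExp, binomExp.add]

lemma const_mul (p : ℝ) (a b : ℕ) (c : ℝ) (H : ℤ → ℝ) :
    binomDiffExp p a b (fun k => c * H k) = c * binomDiffExp p a b H := by
  simp only [binomDiffExp, binomExp.const_mul]

lemma const (p : ℝ) (a b : ℕ) (c : ℝ) : binomDiffExp p a b (fun _ => c) = c := by
  simp only [binomDiffExp, binomExp.const]

lemma mono {p : ℝ} (h0 : 0 ≤ p) (h1 : p ≤ 1) (a b : ℕ) {G H : ℤ → ℝ} (h : ∀ k, G k ≤ H k) :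
    binomDiffExp p a b G ≤ binomDiffExp p a b H :=
  binomExp.mono h0 h1 _ fun _ => binomExp.mono h0 h1 _ fun _ => h _

lemma swap (p : ℝ) (a b : ℕ) (H : ℤ → ℝ) :
    binomDiffExp p b a (fun k => H (-k)) = binomDiffExp p a b H := by
  simp only [binomDiffExp, neg_sub]
  rw [binomExp.comm]

/-- Freeze one variable and apply `binomExp.le_of_step` to the other. A success of `X₂` lowers the
difference, hence the second hypothesis with downward steps; the two covariances add up. -/
lemma le_of_step {p : ℝ} (h0 : 0 ≤ p) (h1 : p ≤ 1) (a b : ℕ) {L F : ℤ → ℝ}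
    (hu : ∀ k, (1 - p) * L k + p * L (k + 1) ≤ F (k + 1) - F k)
    (hd : ∀ k, (1 - p) * L k + p * L (k - 1) ≤ F k - F (k - 1)) :
    (a + b) * (p * (1 - p)) * binomDiffExp p a b L ≤
      binomDiffExp p a b fun k => ((k : ℝ) - (a - b) * p) * F k := by
  have hA : a * (p * (1 - p)) * binomDiffExp p a b L ≤
      binomExp p a fun i => binomExp p b fun j => ((i : ℝ) - a * p) * F (i - j) := by
    unfold binomDiffExp
    rw [binomExp.comm p a b fun i j => L (i - j),
      binomExp.comm p a b fun i j => ((i : ℝ) - a * p) * F (i - j), ← binomExp.const_mul]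
    refine binomExp.mono h0 h1 _ fun j => ?_
    refine binomExp.le_of_step h0 h1 a (H := fun i => F (i - j)) fun i => ?_
    have := hu (i - j)
    push_cast
    rwa [show (i : ℤ) + 1 - j = i - j + 1 by ring]
  have hB : b * (p * (1 - p)) * binomDiffExp p a b L ≤
      binomExp p a fun i => binomExp p b fun j => ((j : ℝ) - b * p) * (-F (i - j)) := by
    unfold binomDiffExp
    rw [← binomExp.const_mul]
    refine binomExp.mono h0 h1 _ fun i => ?_
    refine binomExp.le_of_step h0 h1 b (H := fun j => -F (i - j)) fun j => ?_
    have := hd (i - j)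
    push_cast
    rw [show (i : ℤ) - (j + 1) = i - j - 1 by ring]
    linarith
  have e : (binomDiffExp p a b fun k => ((k : ℝ) - (a - b) * p) * F k) =
      (binomExp p a fun i => binomExp p b fun j => ((i : ℝ) - a * p) * F (i - j)) +
      binomExp p a fun i => binomExp p b fun j => ((j : ℝ) - b * p) * (-F (i - j)) := by
    rw [← binomExp.add]
    unfold binomDiffExp
    congr 1; funext i
    rw [← binomExp.add]
    congr 1; funext j
    push_cast; ring
  rw [e]
  linarith

/-- A variance bound, obtained from `le_of_step` with linear `F` and constant `L`. -/
lemma sq_sub_mean_le {p : ℝ} (h0 : 0 ≤ p) (h1 : p ≤ 1) (a b : ℕ) :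
    binomDiffExp p a b (fun k => ((k : ℝ) - (a - b) * p) ^ 2) ≤ (a + b) * (p * (1 - p)) := by
  have h := le_of_step h0 h1 a b (L := fun _ => -1)
    (F := fun k => -((k : ℝ) - (a - b) * p)) (fun k => by push_cast; linarith)
    (fun k => by push_cast; linarith)
  rw [const] at h
  have e : (fun k : ℤ => ((k : ℝ) - (a - b) * p) * -((k : ℝ) - (a - b) * p)) =
      fun k : ℤ => (-1) * ((k : ℝ) - (a - b) * p) ^ 2 := by
    funext k; ring
  rw [e, const_mul] at h
  linarith

/-- A one-sided normal approximation to the law of the difference of two binomial variables. -/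
theorem cdf_le {p : ℝ} (hp : 0 < p) (hp2 : p ≤ 1 / 2) (a b : ℕ) (hab : 0 < a + b) (m : ℤ) :
    binomDiffExp p a b (fun k => if k ≤ m then 1 else 0) ≤
      stdNormalCDF ((m + (1 - p) - (a - b) * p) / √((a + b) * p * (1 - p)))
        + 1.0125 * (1 - p) / √((a + b) * p * (1 - p)) := by
  have hab' : (0 : ℝ) < a + b := by exact_mod_cast hab
  have hq : 0 < 1 - p := by linarith
  have hv : 0 < (a + b) * p * (1 - p) := by positivity
  set σ := √((a + b) * p * (1 - p)) with hσ
  have hs : 0 < σ := Real.sqrt_pos.2 hv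
  have hs2 : σ ^ 2 = (a + b) * p * (1 - p) := Real.sq_sqrt hv.le
  set μ : ℝ := (a - b) * p with hμ
  -- The shift `1 - p` is the least that serves both directions: the step across `m` needs `1 - p`
  -- going up and `p ≤ 1 - p` going down.
  set z := (m + (1 - p) - μ) / σ with hz
  set h := 1 / σ with hh
  have hh0 : 0 < h := by positivity
  have hhs : h * σ = 1 := by rw [hh]; field_simp
  let w : ℤ → ℝ := fun k => ((k : ℝ) - μ) * h
  have wz : ∀ (k : ℤ) (γ : ℝ), (k : ℝ) + γ ≤ m + (1 - p) → w k + γ * h ≤ z := by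
    intro k γ hk
    have : w k + γ * h = (k + γ - μ) / σ := by simp only [w, hh]; ring
    rw [this, hz]
    gcongr
  let L : ℤ → ℝ := fun k => h * ((if k ≤ m then (1 : ℝ) else 0) - stdNormalCDF z)
    + h * (w k * steinSol z (w k)) - h ^ 2 / 2 * (1 - p) * (|w k| + 1.025)
  have ws : ∀ k : ℤ, w (k + 1) = w k + h := by intro k; simp only [w]; push_cast; ring
  have key := le_of_step hp.le (by linarith) a b (L := L) (F := fun k => steinSol z (w k))
    (fun k => by
      have P1 : 0 ≤ |w k| + 1.025 := by positivity
      have P2 : 0 ≤ |w k + h| + 1.025 := by positivity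
      have st := stein_step (z := z) (w := w k) (α := 1 - p) (β := p)
        (γ := (1 - p) * (if k ≤ m then 1 else 0) + p * (if k + 1 ≤ m then 1 else 0))
        hh0.le hq.le hp.le (by ring)
        (by split_ifs <;> linarith) (by split_ifs <;> linarith) (by
          split_ifs with c1 c2 c2
          · right; apply wz
            have : (k : ℝ) + 1 ≤ m := by exact_mod_cast c2
            linarith
          · right; apply wz
            have : (k : ℝ) ≤ m := by exact_mod_cast c1
            linarith
          · omega
          · left; ring)
      refine le_trans ?_ (ws k ▸ st)
      simp only [L, ws]
      -- As `p ≤ 1/2`, `p² ≤ p (1 - p)`, so the error becomes `1 - p` times a one-step average, as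
      -- `L` requires.
      have : h ^ 2 / 2 * (p ^ 2 * (|w k + h| + 1.025)) ≤
          h ^ 2 / 2 * (p * (1 - p) * (|w k + h| + 1.025)) := by
        gcongr; nlinarith
      linarith)
    (fun k => by
      obtain ⟨l, rfl⟩ : ∃ l, k = l + 1 := ⟨k - 1, by ring⟩
      rw [add_sub_cancel_right]
      have P1 : 0 ≤ |w l| + 1.025 := by positivity
      have P2 : 0 ≤ |w l + h| + 1.025 := by positivity
      have st := stein_step (z := z) (w := w l) (α := p) (β := 1 - p)
        (γ := (1 - p) * (if l + 1 ≤ m then 1 else 0) + p * (if l ≤ m then 1 else 0))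
        hh0.le hp.le hq.le (by ring)
        (by split_ifs <;> linarith) (by split_ifs <;> linarith) (by
          split_ifs with c1 c2 c2
          · right; apply wz
            have : (l : ℝ) + 1 ≤ m := by exact_mod_cast c1
            linarith
          · omega
          · right; apply wz
            have : (l : ℝ) ≤ m := by exact_mod_cast c2
            linarith
          · left; ring)
      refine le_trans ?_ (ws l ▸ st)
      simp only [L, ws]
      have : h ^ 2 / 2 * (p ^ 2 * (|w l| + 1.025)) ≤
          h ^ 2 / 2 * (p * (1 - p) * (|w l| + 1.025)) := by
        gcongr; nlinarith
      linarith)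
  have hE : binomDiffExp p a b L = h * binomDiffExp p a b (fun k => if k ≤ m then 1 else 0)
      + h * binomDiffExp p a b (fun k => w k * steinSol z (w k))
      + (-(h ^ 2 / 2 * (1 - p))) * binomDiffExp p a b (fun k => |w k|)
      + (-(h * stdNormalCDF z) - h ^ 2 / 2 * (1 - p) * 1.025) := by
    rw [← const_mul, ← const_mul, ← const_mul, ← add, ← add,
      ← const p a b (-(h * stdNormalCDF z) - h ^ 2 / 2 * (1 - p) * 1.025), ← add]
    congr 1; funext k
    simp only [L]; ring
  have hF : (binomDiffExp p a b fun k => ((k : ℝ) - μ) * steinSol z (w k)) =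
      σ * binomDiffExp p a b (fun k => w k * steinSol z (w k)) := by
    rw [← const_mul]
    congr 1; funext k
    simp only [w]
    linear_combination (-((k : ℝ) - μ) * steinSol z (((k : ℝ) - μ) * h)) * hhs
  have hW : binomDiffExp p a b (fun k => |w k|) ≤ 1 := by
    have h1 := mono hp.le (by linarith) a b (G := fun k => |w k|)
      (H := fun k => h ^ 2 / 2 * ((k : ℝ) - μ) ^ 2 + 1 / 2) (fun k => by
        have : |w k| ^ 2 = h ^ 2 * ((k : ℝ) - μ) ^ 2 := by rw [sq_abs]; simp only [w]; ring
        -- `|w| ≤ (w² + 1)/2` replaces Cauchy–Schwarz.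
        nlinarith [sq_nonneg (|w k| - 1)])
    rw [add, const_mul, const] at h1
    have h2 := sq_sub_mean_le hp.le (by linarith : p ≤ 1) a b
    rw [← mul_assoc, ← hs2] at h2
    have h3 : h ^ 2 / 2 * binomDiffExp p a b (fun k => ((k : ℝ) - μ) ^ 2) ≤
      h ^ 2 / 2 * σ ^ 2 := by gcongr
    have h4 : h ^ 2 * σ ^ 2 = 1 := by rw [← mul_pow, hhs, one_pow]
    linarith
  rw [hF, ← mul_assoc, ← hs2, hE] at key
  set E1 := binomDiffExp p a b (fun k => if k ≤ m then 1 else 0)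
  set E2 := binomDiffExp p a b (fun k => w k * steinSol z (w k))
  set E3 := binomDiffExp p a b (fun k => |w k|)
  -- The `E2` terms cancel; with `E3 ≤ 1` the constant is `(1 + 1.025)/2 = 1.0125`.
  have k2 : σ * (E1 - stdNormalCDF z) ≤ (1 - p) / 2 * (E3 + 1.025) := by
    have : σ ^ 2 * (h * E1 + h * E2 + -(h ^ 2 / 2 * (1 - p)) * E3 +
        (-(h * stdNormalCDF z) - h ^ 2 / 2 * (1 - p) * 1.025)) =
        (h * σ) * σ * (E1 + E2 - stdNormalCDF z) - (h * σ) ^ 2 * ((1 - p) / 2 * (E3 + 1.025)) := by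
      ring
    rw [this, hhs] at key
    linarith
  have k3 : σ * (E1 - stdNormalCDF z) ≤ 1.0125 * (1 - p) := by nlinarith
  have : E1 - stdNormalCDF z ≤ 1.0125 * (1 - p) / σ := by
    rw [le_div_iff₀ hs]; linarith
  linarith

end binomDiffExp

/-! ### Transfer to random variables. -/

lemma integral_binomial (p : unitInterval) (n : ℕ) (H : ℕ → ℝ) :
    ∫ k, H k ∂(binomial n p) = binomExp p n H := by
  have h1 : ∫ k, H k ∂(binomial n p) =
      ∑ k ∈ Finset.range (n + 1), (n.choose k : ℝ) * ((p : ℝ) ^ k * (1 - p) ^ (n - k) * H k) := by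
    have hI : Finset.Iic n = Finset.range (n + 1) := by ext; simp
    rw [binomial_eq_sum_dirac, integral_finsetSum_measure, hI]
    · refine Finset.sum_congr rfl fun k _ => ?_
      rw [integral_smul_measure, integral_dirac, ENNReal.toReal_ofReal binomial_nonneg, smul_eq_mul]
      ring
    · intro k _
      exact (integrable_dirac (by simp)).smul_measure ENNReal.ofReal_ne_top
  rw [h1]
  clear h1
  induction n generalizing H with
  | zero => simp [binomExp]
  | succ n ih =>
    rw [Finset.sum_choose_succ_mul fun i j => (p : ℝ) ^ i * (1 - (p : ℝ)) ^ j * H i, binomExp,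
      ← ih, ← ih, Finset.mul_sum, Finset.mul_sum]
    congr 1
    · refine Finset.sum_congr rfl fun k hk => ?_
      rw [Nat.sub_add_comm (Finset.mem_range_succ_iff.1 hk), pow_succ]; ring
    · refine Finset.sum_congr rfl fun k _ => ?_
      rw [pow_succ]; ring

section

variable {Ω : Type*} [MeasurableSpace Ω] {P : Measure Ω} [IsProbabilityMeasure P]
  {X₁ X₂ : Ω → ℕ} {a b : ℕ} {p : unitInterval}

lemma measureReal_sub_mem (h₁ : HasLaw X₁ (binomial a p) P) (h₂ : HasLaw X₂ (binomial b p) P)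
    (hI : IndepFun X₁ X₂ P) (A : Set ℤ) :
    P.real {ω | (X₁ ω : ℤ) - X₂ ω ∈ A} = binomDiffExp p a b (A.indicator 1) := by
  let B : Set (ℕ × ℕ) := {x | (x.1 : ℤ) - x.2 ∈ A}
  have hm : P.map (fun ω => (X₁ ω, X₂ ω)) = (binomial a p).prod (binomial b p) := by
    rw [(indepFun_iff_map_prod_eq_prod_map_map h₁.aemeasurable h₂.aemeasurable).1 hI,
      h₁.map_eq, h₂.map_eq]
  have hB : MeasurableSet B := .of_discrete
  have e : P.real {ω | (X₁ ω : ℤ) - X₂ ω ∈ A} = ((binomial a p).prod (binomial b p)).real B := by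
    rw [← hm, measureReal_def, measureReal_def,
      Measure.map_apply_of_aemeasurable (h₁.aemeasurable.prodMk h₂.aemeasurable) hB]
    rfl
  have hint : Integrable (B.indicator (1 : ℕ × ℕ → ℝ)) ((binomial a p).prod (binomial b p)) :=
    (integrable_const (1 : ℝ)).indicator hB
  rw [e, ← integral_indicator_one hB, integral_prod _ hint, binomDiffExp,
    ← integral_binomial]
  refine integral_congr_ae (ae_of_all _ fun i => ?_)
  simp only [← integral_binomial]
  rfl

/-- A one-sided Berry–Esseen bound for the difference of two binomial variables. -/
theorem stdNormalCDF_sub_le_measureReal (h₁ : HasLaw X₁ (binomial a p) P)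
    (h₂ : HasLaw X₂ (binomial b p) P) (hI : IndepFun X₁ X₂ P) (hab : 0 < a + b)
    (hp : 0 < (p : ℝ)) (hp2 : (p : ℝ) ≤ 1 / 2) (M : ℝ) :
    stdNormalCDF ((((a : ℝ) - b) * p - M) / √(((a : ℝ) + b) * p * (1 - p)))
        - 1.41145 * (1 - p) / √(((a : ℝ) + b) * p * (1 - p))
      ≤ P.real {ω | M ≤ (X₁ ω : ℝ) - X₂ ω} := by
  set m : ℤ := ⌈M⌉ - 1 with hm
  have hset : ∀ k : ℤ, M ≤ (k : ℝ) ↔ ¬ k ≤ m := by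
    intro k
    rw [← Int.ceil_le]; omega
  have e : P.real {ω | M ≤ (X₁ ω : ℝ) - X₂ ω} =
      1 - binomDiffExp p a b (fun k => if k ≤ m then 1 else 0) := by
    have h := measureReal_sub_mem h₁ h₂ hI {k : ℤ | M ≤ (k : ℝ)}
    simp only [Set.mem_ofPred_eq, Int.cast_sub, Int.cast_natCast] at h
    rw [h, eq_sub_iff_add_eq, ← binomDiffExp.add]
    convert! binomDiffExp.const p a b 1 using 2
    funext k
    simp only [Set.indicator_apply, Set.mem_ofPred_eq, hset, Pi.one_apply]
    split_ifs <;> norm_num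
  have hq : 0 < 1 - (p : ℝ) := by linarith
  have hab' : (0 : ℝ) < a + b := by exact_mod_cast hab
  have main := binomDiffExp.cdf_le hp hp2 a b hab m
  have hmM : (m : ℝ) ≤ M := by
    have := Int.ceil_lt_add_one M
    rw [hm]; push_cast; linarith
  rw [e]
  set σ := √(((a : ℝ) + b) * p * (1 - p))
  have hs : 0 < σ := Real.sqrt_pos.2 (by positivity)
  -- Undoing the shift costs the maximal density, whence `1.0125 + 0.39895 = 1.41145`.
  have h3 : stdNormalCDF ((m + (1 - p) - (a - b) * p) / σ) ≤
      stdNormalCDF (-((((a : ℝ) - b) * p - M) / σ)) + 0.39895 * ((1 - p) / σ) := by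
    refine le_trans (stdNormalCDF_mono ?_) (stdNormalCDF_add_le _ (by positivity))
    rw [← neg_div, ← add_div]
    gcongr
    linarith
  have h4 := stdNormalCDF_add_neg ((((a : ℝ) - b) * p - M) / σ)
  have h5 : 1.41145 * (1 - (p : ℝ)) / σ =
    1.0125 * (1 - p) / σ + 0.39895 * ((1 - p) / σ) := by ring
  linarith

/-- The factor `1 - p` kept in the error pays for the `q` inside `σ`. -/
lemma one_sub_div_sqrt_le {N p : ℝ} (hN : 0 < N) (hp : 0 ≤ p) (hp1 : p < 1) :
    (1 - p) / √(N * (1 - p)) ≤ 1 / √N := by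
  have hq : 0 < 1 - p := by linarith
  rw [Real.sqrt_mul hN.le, div_le_div_iff₀ (by positivity) (by positivity), one_mul,
    mul_comm (1 - p)]
  gcongr
  exact Real.le_sqrt_of_sq_le (by nlinarith)

/-- `P(= m) = P(≤ m) + P(≥ m) - 1`; by swapping the variables, `cdf_le` bounds both terms. The
constant is `2 · 1.41145 < 3`. -/
lemma measureReal_sub_eq_le (h₁ : HasLaw X₁ (binomial a p) P)
    (h₂ : HasLaw X₂ (binomial b p) P) (hI : IndepFun X₁ X₂ P) (hab : 0 < a + b)
    (hp : 0 < (p : ℝ)) (hp2 : (p : ℝ) ≤ 1 / 2) (m : ℤ) :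
    P.real {ω | (X₁ ω : ℤ) - X₂ ω = m} ≤ 3 / √(((a : ℝ) + b) * p) := by
  have hq : 0 < 1 - (p : ℝ) := by linarith
  have hab' : (0 : ℝ) < a + b := by exact_mod_cast hab
  have m1 := binomDiffExp.cdf_le hp hp2 a b hab m
  have m2 := binomDiffExp.cdf_le hp hp2 b a (by omega) (-m)
  have e : P.real {ω | (X₁ ω : ℤ) - X₂ ω = m} + 1 =
      binomDiffExp p a b (fun k => if k ≤ m then 1 else 0) +
        binomDiffExp p b a (fun k => if k ≤ -m then 1 else 0) := by
    have h := measureReal_sub_mem h₁ h₂ hI {m}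
    simp only [Set.mem_singleton_iff] at h
    rw [h, ← binomDiffExp.swap p b a, ← binomDiffExp.const p a b 1, ← binomDiffExp.add,
      ← binomDiffExp.add]
    congr 1
    funext k
    rw [binomDiffExp.const]
    simp only [Set.indicator_apply, Set.mem_singleton_iff, Pi.one_apply]
    split_ifs <;> first | omega | norm_num
  rw [add_comm (b : ℝ) a] at m2
  have hr := one_sub_div_sqrt_le (N := ((a : ℝ) + b) * p) (by positivity) hp.le
    (by linarith : (p : ℝ) < 1)
  set σ := √(((a : ℝ) + b) * p * (1 - p))
  have hs : 0 < σ := Real.sqrt_pos.2 (by positivity)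
  set y := ((m : ℝ) + (1 - p) - ((a : ℝ) - b) * p) / σ
  have h3 : stdNormalCDF (((-m : ℤ) + (1 - p) - (b - a) * p) / σ) ≤
      stdNormalCDF (-y) + 0.39895 * (2 * ((1 - p) / σ)) := by
    refine le_trans (stdNormalCDF_mono (le_of_eq ?_)) (stdNormalCDF_add_le _ (by positivity))
    simp only [y]
    push_cast
    ring
  have h4 := stdNormalCDF_add_neg y
  have h5 : 1.0125 * (1 - (p : ℝ)) / σ = 1.0125 * ((1 - p) / σ) := by ring
  have h6 : 3 / √(((a : ℝ) + b) * p) = 3 * (1 / √(((a : ℝ) + b) * p)) := by ring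
  have h7 : 0 < (1 - (p : ℝ)) / σ := by positivity
  rw [h6]
  linarith

end

/-! ### Asymptotics and the theorem. -/

lemma eventually_one_div_sqrt_le {N D : ℕ → ℝ} (hD : Tendsto D atTop atTop)
    (hDN : ∀ n, D n ≤ N n) {ε : ℝ} (hε : 0 < ε) :
    ∀ᶠ n in atTop, 1 / √(N n) ≤ ε * min 1 (D n / √(N n)) := by
  filter_upwards [hD.eventually_ge_atTop (1 / ε), hD.eventually_ge_atTop ((1 / ε) ^ 2),
    hD.eventually_gt_atTop 0] with n h1 h2 h3
  have hN : 0 < N n := h3.trans_le (hDN n)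
  have hs : 0 < √(N n) := Real.sqrt_pos.2 hN
  have hs2 : 1 / ε ≤ √(N n) := Real.le_sqrt_of_sq_le (h2.trans (hDN n))
  rw [div_le_iff₀ hε] at h1 hs2
  rw [mul_min_of_nonneg _ _ hε.le]
  refine le_min ?_ ?_
  · rw [div_le_iff₀ hs]; linarith
  · rw [← mul_div_assoc]
    gcongr
    linarith

theorem lemma2p3 :
    ∃ ζ : ℝ, 0 < ζ ∧ ζ < 1 / 2 ∧
      ∀ (a₁ a₂ : ℕ → ℕ) (p : ℕ → unitInterval)
        (Ω : ℕ → Type*) [∀ n, MeasurableSpace (Ω n)]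
        (P : ∀ n, Measure (Ω n)) [∀ n, IsProbabilityMeasure (P n)]
        (X₁ X₂ : ∀ n, Ω n → ℕ),
        Tendsto (fun n => (p n : ℝ)) atTop (𝓝 0) →
        Tendsto a₂ atTop atTop →
        (∀ n, a₂ n ≤ a₁ n) →
        Tendsto (fun n => min (a₂ n : ℝ) ((a₁ n : ℝ) - a₂ n) * (p n : ℝ)) atTop atTop →
        (∀ n, HasLaw (X₁ n) (binomial (a₁ n) (p n)) (P n)) →
        (∀ n, HasLaw (X₂ n) (binomial (a₂ n) (p n)) (P n)) →
        (∀ n, IndepFun (X₁ n) (X₂ n) (P n)) →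
        (∀ (M : ℝ) (n : ℕ), 1 ≤ a₂ n → 0 < (p n : ℝ) → (p n : ℝ) ≤ 1 / 2 →
          stdNormalCDF ((((a₁ n : ℝ) - a₂ n) * p n - M) /
              √(((a₁ n : ℝ) + a₂ n) * p n * (1 - p n)))
              - 2 * ζ / √((a₂ n : ℝ) * p n)
            ≤ (P n).real {ω | M ≤ (X₁ n ω : ℝ) - X₂ n ω}) ∧
        (∀ M : ℝ, ∀ᶠ n in atTop,
          1 / 2 + 1 / 5 * min 1 ((((a₁ n : ℝ) - a₂ n) * p n) /
              √(((a₁ n : ℝ) + a₂ n) * p n))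
            ≤ (P n).real {ω | M ≤ (X₁ n ω : ℝ) - X₂ n ω}) ∧
        (∀ m : ℤ,
          (fun n => (P n).real {ω | (X₁ n ω : ℤ) - X₂ n ω = m}) =o[atTop]
            (fun n => (P n).real {ω | m ≤ (X₁ n ω : ℤ) - X₂ n ω}
              - (P n).real {ω | (X₁ n ω : ℤ) - X₂ n ω < m})) := by
  -- Any value from `1.41145 / (2√2) ≈ 0.49902` up to 1/2 would do.
  refine ⟨0.49925, by norm_num, by norm_num, ?_⟩
  intro a₁ a₂ p Ω _ P _ X₁ X₂ hp ha₂ hle hmin h₁ h₂ hI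
  have hD : Tendsto (fun n => ((a₁ n : ℝ) - a₂ n) * p n) atTop atTop :=
    tendsto_atTop_mono
      (fun n => mul_le_mul_of_nonneg_right (min_le_right _ _) (p n).2.1) hmin
  have hDN : ∀ n, ((a₁ n : ℝ) - a₂ n) * p n ≤ ((a₁ n : ℝ) + a₂ n) * p n := fun n => by
    have := (p n).2.1
    gcongr
    have : (0 : ℝ) ≤ a₂ n := by positivity
    linarith
  have hreg : ∀ᶠ n in atTop, 0 < a₁ n + a₂ n ∧ 0 < (p n : ℝ) ∧ (p n : ℝ) ≤ 1 / 2 := by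
    filter_upwards [ha₂.eventually_ge_atTop 1, hmin.eventually_gt_atTop 0,
      hp.eventually_le_const (show (0 : ℝ) < 1 / 2 by norm_num)] with n h1 h2 h3
    refine ⟨by omega, ?_, h3⟩
    refine lt_of_le_of_ne (p n).2.1 fun h0 => ?_
    rw [← h0, mul_zero] at h2
    exact lt_irrefl _ h2
  have hsmall := fun {ε : ℝ} (hε : 0 < ε) => eventually_one_div_sqrt_le hD hDN hε
  have part2 : ∀ M : ℝ, ∀ᶠ n in atTop,
      1 / 2 + 1 / 5 * min 1 ((((a₁ n : ℝ) - a₂ n) * p n) / √(((a₁ n : ℝ) + a₂ n) * p n))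
        ≤ (P n).real {ω | M ≤ (X₁ n ω : ℝ) - X₂ n ω} := by
    intro M
    -- `M ≤ D/10` keeps 0.9 of the drift, and `0.24 · 0.9 - 1.41145 · 0.01 > 1/5`.
    filter_upwards [hreg, hsmall (ε := 0.01) (by norm_num), hD.eventually_ge_atTop (10 * M),
      hD.eventually_gt_atTop 0] with n ⟨hab, hp0, hp2⟩ hs hM hD0
    have hq : 0 < 1 - (p n : ℝ) := by linarith
    have main := stdNormalCDF_sub_le_measureReal (h₁ n) (h₂ n) (hI n) hab hp0 hp2 M
    have hN : 0 < ((a₁ n : ℝ) + a₂ n) * p n := hD0.trans_le (hDN n)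
    have hr := one_sub_div_sqrt_le hN hp0.le (by linarith : (p n : ℝ) < 1)
    refine le_trans ?_ main
    set N := ((a₁ n : ℝ) + a₂ n) * p n
    set D := ((a₁ n : ℝ) - a₂ n) * p n
    have hsN : 0 < √N := Real.sqrt_pos.2 hN
    have hσ : 0 < √(N * (1 - p n)) := Real.sqrt_pos.2 (by positivity)
    have hσN : √(N * (1 - p n)) ≤ √N := Real.sqrt_le_sqrt (by nlinarith)
    have hx : 0 < D / √N := by positivity
    have h1 : 0.9 * (D / √N) ≤ (D - M) / √(N * (1 - p n)) := by
      have : 0.9 * D ≤ D - M := by linarith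
      rw [← mul_div_assoc]
      gcongr
      linarith
    have h2 := (half_add_min_le_stdNormalCDF (x := 0.9 * (D / √N)) (by positivity)).trans
      (stdNormalCDF_mono h1)
    have h3 : 0.9 * min 1 (D / √N) ≤ min 1 (0.9 * (D / √N)) := by
      rw [mul_min_of_nonneg _ _ (by norm_num)]
      exact min_le_min_right _ (by norm_num)
    have h4 : 1.41145 * (1 - (p n : ℝ)) / √(N * (1 - p n)) =
      1.41145 * ((1 - p n) / √(N * (1 - p n))) := by ring
    have h5 : 0 < min 1 (D / √N) := lt_min one_pos hx
    rw [h4]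
    linarith
  refine ⟨?_, part2, ?_⟩
  · intro M n ha hp0 hp2
    have hab : 0 < a₁ n + a₂ n := by omega
    refine le_trans ?_ (stdNormalCDF_sub_le_measureReal (h₁ n) (h₂ n) (hI n) hab hp0 hp2 M)
    have hq : 0 < 1 - (p n : ℝ) := by linarith
    have ha' : (1 : ℝ) ≤ a₂ n := by exact_mod_cast ha
    have hle' : (a₂ n : ℝ) ≤ a₁ n := by exact_mod_cast hle n
    have hl : 0 < (a₂ n : ℝ) * p n := by positivity
    refine sub_le_sub_left ?_ _
    rw [div_le_div_iff₀ (Real.sqrt_pos.2 (by positivity)) (Real.sqrt_pos.2 hl)]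
    refine abs_le_of_sq_le_sq' ?_ (by positivity) |>.2
    rw [mul_pow, mul_pow, mul_pow _ (√_), Real.sq_sqrt hl.le, Real.sq_sqrt (by positivity)]
    have h1 : 2 * ((a₂ n : ℝ) * p n * (1 - p n)) ≤
        ((a₁ n : ℝ) + a₂ n) * p n * (1 - p n) := by
      have := mul_le_mul_of_nonneg_right hle' (mul_pos hp0 hq).le
      linarith
    have h2 : (a₂ n : ℝ) * p n * (1 - p n) * (1 - p n) ≤ (a₂ n : ℝ) * p n * (1 - p n) := by
      have : 0 < (a₂ n : ℝ) * p n * (1 - p n) := by positivity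
      nlinarith
    have h3 : 0 < (a₂ n : ℝ) * p n * (1 - p n) := by positivity
    norm_num
    linarith
  · intro m
    rw [isLittleO_iff]
    intro c hc
    -- By part 2 the difference is at least 2/5 of the minimum; this `ε` puts `3/√N` below `c` times
    -- that.
    filter_upwards [hreg, hsmall (ε := c * (2 / 5) / 3) (by positivity), part2 m,
      hD.eventually_gt_atTop 0] with n ⟨hab, hp0, hp2⟩ hs h2 hD0
    have h3 := measureReal_sub_eq_le (h₁ n) (h₂ n) (hI n) hab hp0 hp2 m
    have e1 : (P n).real {ω | (m : ℝ) ≤ (X₁ n ω : ℝ) - X₂ n ω} =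
        (P n).real {ω | m ≤ (X₁ n ω : ℤ) - X₂ n ω} := by
      congr 1; ext ω; simp only [Set.mem_ofPred_eq]; exact_mod_cast Iff.rfl
    have e2 : (P n).real {ω | m ≤ (X₁ n ω : ℤ) - X₂ n ω} +
        (P n).real {ω | (X₁ n ω : ℤ) - X₂ n ω < m} = 1 := by
      have i1 := measureReal_sub_mem (h₁ n) (h₂ n) (hI n) {k | m ≤ k}
      have i2 := measureReal_sub_mem (h₁ n) (h₂ n) (hI n) {k | k < m}
      simp only [Set.mem_ofPred_eq] at i1 i2
      rw [i1, i2, ← binomDiffExp.add]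
      convert! binomDiffExp.const (p n) (a₁ n) (a₂ n) 1 using 2
      funext k
      simp only [Set.indicator_apply, Set.mem_ofPred_eq, Pi.one_apply]
      split_ifs <;> first | omega | norm_num
    rw [e1] at h2
    rw [Real.norm_of_nonneg measureReal_nonneg]
    refine h3.trans (le_trans ?_ (mul_le_mul_of_nonneg_left (Real.le_norm_self _) hc.le))
    set x := min 1 ((((a₁ n : ℝ) - a₂ n) * p n) / √(((a₁ n : ℝ) + a₂ n) * p n))
    set t := √(((a₁ n : ℝ) + a₂ n) * p n)
    have h4 : 3 / t ≤ c * (2 / 5 * x) := by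
      have : 3 / t = 3 * (1 / t) := by ring
      rw [this]; linarith
    refine h4.trans (mul_le_mul_of_nonneg_left ?_ hc.le)
    linarith
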